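/- Let $K$ be a (commutative) field. Let $\chi(K)$ be the space of orders of $K$, i.e. of subsets $P\subset K$ with $P+P\subseteq P$, $P\cdot P\subseteq P$, $-1\notin P$, $P\cup -P=K$, with the Harrison topology generated by the sets $H(a)=\{P\mid a\in P\}$, $a\in K$. For $P\in\chi(K)$ write $a\le_P b$ for $b-a\in P$, let $A(P)=\{a\in K\mid \exists r\in\mathbb{Q},\ -r\le_P a\le_P r\}$, and let $\lambda_P:K\to\mathbb{R}\cup\{\infty\}$ be the $\mathbb{R}$-place given by $\lambda_P(a)=\infty$ if $a\notin A(P)$ and $\lambda_P(a)=\inf\{r\in\mathbb{Q}\mid a\le_P r\}$ if $a\in A(P)$. Let $M(K)=\{\lambda_P\mid P\in\chi(K)\}$, with the coarsest topology making all evaluations $\lambda\mapsto\lambda(a)\in\mathbb{R}\cup\{\infty\}$ ($a\in K$) continuous, where $\mathbb{R}\cup\{\infty\}$ is the one-point compactification of $\mathbb{R}$. Let $H(K)$ be the real holomorphy ring of $K$, i.e. the intersection of all valuation rings of $K$ whose residue field is orderable. Let $\mathrm{Hom}(H(K),\mathbb{R})$ be the set of ring homomorphisms with the topology of pointwise convergence.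 Let $\mathrm{Sper}\,H(K)$ be the real spectrum of $H(K)$, i.e. the set of pairs $\alpha=(\mathfrak p,\bar\alpha)$ of a prime ideal $\mathfrak p$ of $H(K)$ and an order $\bar\alpha$ of the fraction field of $H(K)/\mathfrak p$, each identified with the set of elements of $H(K)$ that are nonnegative at $\alpha$, with the topology generated by the sets $\{\alpha\mid a(\alpha)>0\}$, $a\in H(K)$; $\beta$ is a specialization of $\alpha$ iff $\alpha\subseteq\beta$. Let $\mathrm{MinSper}\,H(K)$ and $\mathrm{MaxSper}\,H(K)$ be the subspaces of the minimal and of the maximal points for inclusion. Then the diagram $$\begin{array}{ccccc} \chi(K) & & \xrightarrow{\ \mathrm{speri}\ } & & \mathrm{MinSper}\,H(K)\\ {\scriptstyle\Lambda}\downarrow & & & & \downarrow{\scriptstyle \mathrm{sp}}\\ M(K) & \xrightarrow{\ \mathrm{res}\ } & \mathrm{Hom}(H(K),\mathbb{R}) & \xrightarrow{\ j\ } & \mathrm{MaxSper}\,H(K) \end{array}$$ is (well defined and) commutative, where $\Lambda(P)=\lambda_P$, $\mathrm{speri}(P)=P\cap H(K)$, $\mathrm{sp}(\alpha)$ is the unique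 maximal specialization of $\alpha$, $\mathrm{res}(\lambda)=\lambda|_{H(K)}$, and $j(\varphi)=\varphi^{-1}(\mathbb{R}^2)=\{a\mid\varphi(a)\ge 0\}$. The horizontal maps $\mathrm{speri}$, $\mathrm{res}$, $j$ are homeomorphisms and the vertical maps $\Lambda$, $\mathrm{sp}$ are continuous surjections. Hence $\chi(K)$ is homeomorphic to $\mathrm{MinSper}\,H(K)$, and $M(K)$ is homeomorphic to $\mathrm{MaxSper}\,H(K)$. Moreover all five spaces are compact Hausdorff, and the topologies of $M(K)$ and $\mathrm{MaxSper}\,H(K)$ are the quotient topologies coming from $\Lambda$ and $\mathrm{sp}$. -/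

import Mathlib

open Topology

noncomputable section

namespace RealPlaces

/-! ### The space of orders of a field -/

/-- The space `χ(K)` of orders of a field `K`: the subsets `P` with `P + P ⊆ P`, `P · P ⊆ P`,
`-1 ∉ P` and `P ∪ -P = K` (such a `P` automatically contains all squares). -/
def OrderSpace (K : Type*) [Field K] : Type _ :=
  {P : RingPreordering K // HasMemOrNegMem P}

/-- The Harrison topology, generated by the sets `H(a) = {P | a ∈ P}`. -/
instance (K : Type*) [Field K] : TopologicalSpace (OrderSpace K) :=
  TopologicalSpace.generateFrom (Set.range fun a : K => {P : OrderSpace K | a ∈ P.1})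

/-! ### The real spectrum of a ring -/

/-- The real spectrum `Sper R`. A point, that is a prime ideal `p` together with an order of the
fraction field of `R ⧸ p`, is given by the set of the elements of `R` which are nonnegative at
this point: a subset `α` with `α + α ⊆ α`, `α · α ⊆ α`, `-1 ∉ α`, `α ∪ -α = R` and
`p = α ∩ -α` a prime ideal. -/
def RealSpectrum (R : Type*) [CommRing R] : Type _ :=
  {α : RingPreordering R // α.IsOrdering}

/-- The topology of the real spectrum, generated by the sets `{α | a(α) > 0} = {α | -a ∉ α}`. -/
instance (R : Type*) [CommRing R] : TopologicalSpace (RealSpectrum R) :=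
  TopologicalSpace.generateFrom (Set.range fun a : R => {α : RealSpectrum R | -a ∉ α.1})

/-- Inclusion of points of the real spectrum; `α ≤ β` means that `β` is a specialization of `α`,
see `specializes_iff_le`. -/
instance (R : Type*) [CommRing R] : PartialOrder (RealSpectrum R) :=
  inferInstanceAs (PartialOrder {α : RingPreordering R // α.IsOrdering})

theorem specializes_iff_le {R : Type*} [CommRing R] {α β : RealSpectrum R} :
    α ⤳ β ↔ α ≤ β := by
  rw [specializes_iff_forall_open]
  constructor
  · intro h a ha
    by_contra hb
    have := h _ (TopologicalSpace.isOpen_generateFrom_of_mem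
      (g := Set.range fun a : R => {α : RealSpectrum R | -a ∉ α.1}) ⟨-a, rfl⟩)
      (by simpa using hb)
    simp at this
    exact this ha
  · intro h s hs
    induction hs with
    | basic s hs =>
      obtain ⟨a, rfl⟩ := hs
      intro hb ha
      exact hb (h ha)
    | univ => simp
    | inter s t _ _ h1 h2 => exact fun hb => ⟨h1 hb.1, h2 hb.2⟩
    | sUnion S _ ih =>
      rintro ⟨s, hs, hb⟩
      exact ⟨s, hs, ih s hs hb⟩

/-- The space of minimal points of the real spectrum, with the subspace topology. -/
abbrev MinSper (R : Type*) [CommRing R] : Type _ := {α : RealSpectrum R // IsMin α}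

/-- The space of maximal (that is, closed) points of the real spectrum, with the subspace
topology. -/
abbrev MaxSper (R : Type*) [CommRing R] : Type _ := {α : RealSpectrum R // IsMax α}

theorem RealSpectrum.mem_or_neg_mem {R : Type*} [CommRing R] (α : RealSpectrum R) (a : R) :
    a ∈ α.1 ∨ -a ∈ α.1 :=
  have := α.2
  HasMemOrNegMem.mem_or_neg_mem α.1 a

/-- The specializations of a point of the real spectrum form a chain. -/
theorem RealSpectrum.le_total_of_le {R : Type*} [CommRing R] {α β γ : RealSpectrum R}
    (hβ : α ≤ β) (hγ : α ≤ γ) : β ≤ γ ∨ γ ≤ β := by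
  by_contra! h
  obtain ⟨b, hb, hb'⟩ := SetLike.not_le_iff_exists (p := β.1) (q := γ.1) |>.1 h.1
  obtain ⟨c, hc, hc'⟩ := SetLike.not_le_iff_exists (p := γ.1) (q := β.1) |>.1 h.2
  rcases α.mem_or_neg_mem (b - c) with h | h
  · exact hb' (by simpa using add_mem (hγ h) hc)
  · exact hc' (by simpa using add_mem (hβ h) hb)

/-- Every point of the real spectrum has a unique maximal specialization. -/
theorem RealSpectrum.existsUnique_max {R : Type*} [CommRing R] (α : RealSpectrum R) :
    ∃! β : MaxSper R, α ≤ β.1 := by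
  have key : ∀ x y : R, (∃ β, α ≤ β ∧ x ∈ β.1) → (∃ β, α ≤ β ∧ y ∈ β.1) →
      ∃ β, α ≤ β ∧ x ∈ β.1 ∧ y ∈ β.1 := by
    rintro x y ⟨β, hβ, hx⟩ ⟨γ, hγ, hy⟩
    rcases le_total_of_le hβ hγ with h | h
    · exact ⟨γ, hγ, h hx, hy⟩
    · exact ⟨β, hβ, hx, h hy⟩
  let M : RingPreordering R := RingPreordering.mk' {x | ∃ β, α ≤ β ∧ x ∈ β.1}
    (fun {x y} hx hy => by
      obtain ⟨β, h, hx, hy⟩ := key _ _ hx hy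
      exact ⟨β, h, add_mem hx hy⟩)
    (fun {x y} hx hy => by
      obtain ⟨β, h, hx, hy⟩ := key _ _ hx hy
      exact ⟨β, h, mul_mem hx hy⟩)
    (fun x => ⟨α, le_rfl, by simp⟩)
    (by rintro ⟨β, -, h⟩; exact β.1.neg_one_notMem h)
  have : HasMemOrNegMem M := ⟨fun x => by
    rcases α.mem_or_neg_mem x with h | h
    · exact Or.inl ⟨α, le_rfl, h⟩
    · exact Or.inr ⟨α, le_rfl, h⟩⟩
  have hM : M.IsOrdering := RingPreordering.IsOrdering.mk' M (by
    intro x y hxy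
    obtain ⟨β, hβ, h1, h2⟩ := key _ _ hxy.1 hxy.2
    have := β.2
    have : x * y ∈ β.1.support := ⟨h1, h2⟩
    rcases Ideal.IsPrime.mem_or_mem inferInstance this with h | h
    · exact Or.inl ⟨⟨β, hβ, h.1⟩, ⟨β, hβ, h.2⟩⟩
    · exact Or.inr ⟨⟨β, hβ, h.1⟩, ⟨β, hβ, h.2⟩⟩)
  let μ : RealSpectrum R := ⟨M, hM⟩
  have hle : ∀ β : RealSpectrum R, α ≤ β → β ≤ μ := fun β h x hx => ⟨β, h, hx⟩
  refine ⟨⟨μ, fun β h => hle β ((hle α le_rfl).trans h)⟩, hle α le_rfl, ?_⟩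
  intro β hβ
  exact Subtype.ext (le_antisymm (hle _ hβ) (β.2 (hle _ hβ)))

/-- The specialization map `sp`, sending `α` to its unique maximal specialization. -/
def sp (R : Type*) [CommRing R] (α : MinSper R) : MaxSper R :=
  α.1.existsUnique_max.choose

/-! ### Real places -/

/-- The order relation `a ≤_P b` attached to an order `P`. -/
def OrderSpace.le {K : Type*} [Field K] (P : OrderSpace K) (a b : K) : Prop := b - a ∈ P.1

/-- The ring `A(P)`, the convex hull of `ℚ` in `K` for the order `P`. -/
def OrderSpace.A {K : Type*} [Field K] (P : OrderSpace K) : Set K :=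
  {a | ∃ r : ℚ, P.le (-(r : K)) a ∧ P.le a r}

open Classical in
/-- The `ℝ`-place `λ_P : K → ℝ ∪ {∞}` attached to an order `P`. Here `ℝ ∪ {∞}` is the one-point
compactification of `ℝ`. -/
def OrderSpace.place {K : Type*} [Field K] (P : OrderSpace K) (a : K) : OnePoint ℝ :=
  if a ∈ P.A then ((sInf {x : ℝ | ∃ r : ℚ, (r : ℝ) = x ∧ P.le a r} : ℝ) : OnePoint ℝ)
  else OnePoint.infty

/-- The space `M(K)` of `ℝ`-places of `K`. -/
def PlaceSpace (K : Type*) [Field K] : Type _ :=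
  {l : K → OnePoint ℝ // ∃ P : OrderSpace K, P.place = l}

/-- The coarsest topology on `M(K)` making all evaluation maps `M(K) → ℝ ∪ {∞}` continuous. -/
instance (K : Type*) [Field K] : TopologicalSpace (PlaceSpace K) :=
  ⨅ a : K, TopologicalSpace.induced (fun l : PlaceSpace K => l.1 a) inferInstance

/-- The map `Λ : χ(K) → M(K)`, `P ↦ λ_P`. -/
def Lam (K : Type*) [Field K] (P : OrderSpace K) : PlaceSpace K := ⟨P.place, P, rfl⟩

/-! ### The real holomorphy ring -/

/-- A valuation ring of `K` is real if its residue field is orderable. -/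
def IsRealValuationRing {K : Type*} [Field K] (A : ValuationSubring K) : Prop :=
  Nonempty (OrderSpace (IsLocalRing.ResidueField A))

/-- The real holomorphy ring `H(K)`: the intersection of all real valuation rings of `K`. -/
def realHolomorphyRing (K : Type*) [Field K] : Subring K :=
  ⨅ A : {A : ValuationSubring K // IsRealValuationRing A}, A.1.toSubring

/-- The space `Hom(R, ℝ)` of ring homomorphisms from `R` to `ℝ`. -/
def RealHom (R : Type*) [CommRing R] : Type _ := R →+* ℝ

instance (R : Type*) [CommRing R] : FunLike (RealHom R) R ℝ :=
  inferInstanceAs (FunLike (R →+* ℝ) R ℝ)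

instance (R : Type*) [CommRing R] : RingHomClass (RealHom R) R ℝ :=
  inferInstanceAs (RingHomClass (R →+* ℝ) R ℝ)

/-- The topology of pointwise convergence on `Hom(R, ℝ)`. -/
instance (R : Type*) [CommRing R] : TopologicalSpace (RealHom R) :=
  ⨅ a : R, TopologicalSpace.induced (fun f : RealHom R => f a) inferInstance

/-! ### The horizontal maps -/

/-- The map `speri : χ(K) → MinSper H(K)`, `P ↦ P ∩ H(K)`. -/
def speri (K : Type*) [Field K] (P : OrderSpace K) : MinSper (realHolomorphyRing K) :=
  let Q : RingPreordering (realHolomorphyRing K) :=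
    RingPreordering.mk' {a | (a : K) ∈ P.1}
      (fun {x y} hx hy => add_mem (S := RingPreordering K) hx hy)
      (fun {x y} hx hy => mul_mem (S := RingPreordering K) hx hy)
      (fun x => P.1.mul_self_mem (x : K))
      (fun h => P.1.neg_one_notMem (by simpa using h))
  have htot : HasMemOrNegMem Q := ⟨fun x => P.2.mem_or_neg_mem (x : K)⟩
  have hzero : ∀ x : realHolomorphyRing K, x ∈ Q → -x ∈ Q → x = 0 := fun x h h' =>
    Subtype.ext (P.1.eq_zero_of_mem_of_neg_mem (x := (x : K)) h h')
  have hQ : Q.IsOrdering := RingPreordering.IsOrdering.mk' Q (by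
    intro x y hxy
    have h0 : x * y = 0 := hzero _ hxy.1 hxy.2
    rcases mul_eq_zero.1 h0 with rfl | rfl
    · exact Or.inl (zero_mem _)
    · exact Or.inr (zero_mem _))
  ⟨⟨Q, hQ⟩, by
    intro β hβ x hx
    rcases β.mem_or_neg_mem x with h | h
    · exact h
    · rw [hzero x hx (hβ h)]
      exact zero_mem β.1⟩

/-- The map `j : Hom(R, ℝ) → MaxSper R`, `φ ↦ φ⁻¹(ℝ²)`, where `ℝ² = {x | 0 ≤ x}`. -/
def j (R : Type*) [CommRing R] (φ : RealHom R) : MaxSper R :=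
  let Q : RingPreordering R :=
    RingPreordering.mk' {a | 0 ≤ φ a}
      (fun {x y} hx hy => by
        simp only [Set.mem_ofPred_eq, map_add] at *
        exact add_nonneg hx hy)
      (fun {x y} hx hy => by
        simp only [Set.mem_ofPred_eq, map_mul] at *
        exact mul_nonneg hx hy)
      (fun x => by simpa using mul_self_nonneg (φ x))
      (by simp only [Set.mem_ofPred_eq, map_neg, map_one]; norm_num)
  have hmem : ∀ x, x ∈ Q ↔ 0 ≤ φ x := fun x => Iff.rfl
  have htot : HasMemOrNegMem Q := ⟨fun x => by
    rw [hmem, hmem, map_neg, neg_nonneg]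
    exact le_total _ _⟩
  have hQ : Q.IsOrdering := RingPreordering.IsOrdering.mk' Q (by
    intro x y hxy
    have hs : ∀ z, z ∈ Q.support ↔ φ z = 0 := fun z => by
      rw [RingPreordering.mem_support, hmem, hmem, map_neg, neg_nonneg]
      exact ⟨fun h => le_antisymm h.2 h.1, fun h => ⟨h.ge, h.le⟩⟩
    rw [hs] at *
    rw [hs]
    simpa using hxy)
  ⟨⟨Q, hQ⟩, by
    intro β hβ b hb
    by_contra hneg
    have hneg : φ b < 0 := by simpa [hmem] using hneg
    obtain ⟨n, hn⟩ := exists_nat_gt (1 / (-φ b))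
    rw [div_lt_iff₀ (by linarith)] at hn
    have h1 : -(n * b + 1) ∈ Q := by
      rw [hmem]
      simp only [map_neg, map_add, map_mul, map_natCast, map_one]
      linarith
    have h2 : (n : R) * b ∈ β.1 := mul_mem (natCast_mem β.1 n) hb
    refine β.1.neg_one_notMem ?_
    have := add_mem (hβ h1) h2
    simpa using this⟩

/-! Restriction of `ℝ`-places to the real holomorphy ring. The next facts show that the values
there are finite and that the restriction is a ring homomorphism. -/

/-- The linear order on `K` attached to `P`. -/
abbrev OrderSpace.linearOrder {K : Type*} [Field K] (P : OrderSpace K) : LinearOrder K :=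
  open Classical in
  { le := P.le
    le_refl := fun a => by simp [OrderSpace.le]
    le_trans := fun a b c h h' => by
      have := add_mem (S := RingPreordering K) h h'
      simpa [OrderSpace.le] using this
    le_antisymm := fun a b h h' => by
      have : b - a = 0 := P.1.eq_zero_of_mem_of_neg_mem h (by simpa [OrderSpace.le] using h')
      exact (sub_eq_zero.1 this).symm
    le_total := fun a b => by
      have := P.2.mem_or_neg_mem (b - a)
      simpa [OrderSpace.le] using this
    toDecidableLE := fun _ _ => Classical.propDecidable _ }

theorem OrderSpace.isOrderedRing {K : Type*} [Field K] (P : OrderSpace K) :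
    @IsOrderedRing K _ P.linearOrder.toPartialOrder := by
  let := P.linearOrder
  have hle : ∀ a b : K, a ≤ b ↔ b - a ∈ P.1 := fun _ _ => Iff.rfl
  have : IsOrderedAddMonoid K := ⟨fun a b h c => by
    rw [hle] at *; simpa using h, fun a b h c => by
    rw [hle] at *; simpa using h⟩
  have : ZeroLEOneClass K := ⟨by rw [hle, sub_zero]; exact one_mem P.1⟩
  exact IsOrderedRing.of_mul_nonneg fun x y hx hy => by
    rw [hle, sub_zero] at *
    exact mul_mem hx hy

/-- The nonnegative elements of an ordered field form an order. -/
def orderOfLinearOrder (k : Type*) [Field k] [LinearOrder k] [IsOrderedRing k] : OrderSpace k :=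
  ⟨RingPreordering.mk' {x : k | 0 ≤ x} add_nonneg mul_nonneg mul_self_nonneg
      (by rw [Set.mem_ofPred_eq, neg_nonneg]; exact not_le.2 zero_lt_one),
    ⟨fun x => by
      simp only [RingPreordering.mem_mk', Set.mem_ofPred_eq, neg_nonneg]
      exact le_total 0 x⟩⟩

theorem exists_ringHom_of_order {K : Type*} [Field K] (P : OrderSpace K) :
    ∃ f : realHolomorphyRing K →+* ℝ,
      ∀ a : realHolomorphyRing K, P.place (a : K) = ((f a : ℝ) : OnePoint ℝ) := by
  let := P.linearOrder
  have := P.isOrderedRing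
  have hle : ∀ a b : K, P.le a b ↔ a ≤ b := fun _ _ => Iff.rfl
  have hfin : ∀ a : K, a ∈ P.A ↔ 0 ≤ ArchimedeanClass.mk a := by
    intro a
    constructor
    · rintro ⟨r, h1, h2⟩
      rw [hle] at h1 h2
      obtain ⟨n, hn⟩ := exists_nat_ge r
      have hn' : (r : K) ≤ n := by exact_mod_cast hn
      rw [← ArchimedeanClass.mk_one, ArchimedeanClass.mk_le_mk]
      refine ⟨n, ?_⟩
      rw [abs_one, nsmul_one, abs_le]
      constructor <;> linarith
    · intro h
      obtain ⟨n, hn⟩ := ArchimedeanClass.exists_nat_ge_of_mk_nonneg h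
      obtain ⟨m, hm⟩ := ArchimedeanClass.exists_nat_ge_of_mk_nonneg
        (x := -a) (by rwa [ArchimedeanClass.mk_neg])
      refine ⟨(n + m : ℕ), ?_, ?_⟩ <;> rw [hle] <;> push_cast
      · have : (0 : K) ≤ n := Nat.cast_nonneg n
        linarith
      · have : (0 : K) ≤ m := Nat.cast_nonneg m
        linarith
  have hpl : ∀ a : K, 0 ≤ ArchimedeanClass.mk a →
      P.place a = ((ArchimedeanClass.stdPart a : ℝ) : OnePoint ℝ) := by
    intro a ha
    rw [OrderSpace.place, if_pos ((hfin a).2 ha)]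
    congr 1
    have hlow : ∀ x ∈ {x : ℝ | ∃ r : ℚ, (r : ℝ) = x ∧ P.le a r},
        ArchimedeanClass.stdPart a ≤ x := by
      rintro _ ⟨r, rfl, hr⟩
      have := ArchimedeanClass.stdPart_monotoneOn ha (ArchimedeanClass.mk_ratCast_nonneg r) hr
      simpa using this
    have hmem : ∀ r : ℚ, ArchimedeanClass.stdPart a < r → P.le a r := by
      intro r hr
      rw [hle]
      by_contra! h
      have := ArchimedeanClass.stdPart_monotoneOn (ArchimedeanClass.mk_ratCast_nonneg r) ha h.le
      rw [ArchimedeanClass.stdPart_ratCast] at this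
      exact absurd hr (not_lt.2 this)
    refine csInf_eq_of_forall_ge_of_forall_gt_exists_lt ?_ hlow ?_
    · obtain ⟨r, hr⟩ := exists_rat_gt (ArchimedeanClass.stdPart a)
      exact ⟨r, r, rfl, hmem r hr⟩
    · intro w hw
      obtain ⟨r, hr, hr'⟩ := exists_rat_btwn hw
      exact ⟨r, ⟨r, rfl, hmem r hr⟩, hr'⟩
  have hH : ∀ a : realHolomorphyRing K, 0 ≤ ArchimedeanClass.mk (a : K) := by
    intro a
    have hreal : IsRealValuationRing (ArchimedeanClass.addValuation K).toValuation.valuationSubring :=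
      ⟨orderOfLinearOrder (ArchimedeanClass.FiniteResidueField K)⟩
    have ha := (Subring.mem_iInf.1 a.2) ⟨_, hreal⟩
    exact ha
  refine ⟨{ toFun := fun a => ArchimedeanClass.stdPart (a : K)
            map_one' := by simp
            map_zero' := by simp
            map_add' := fun a b => by simpa using ArchimedeanClass.stdPart_add (hH a) (hH b)
            map_mul' := fun a b => by simpa using ArchimedeanClass.stdPart_mul (hH a) (hH b) },
          fun a => hpl a (hH a)⟩

theorem PlaceSpace.existsUnique_restriction {K : Type*} [Field K] (l : PlaceSpace K) :
    ∃! f : RealHom (realHolomorphyRing K),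
      ∀ a : realHolomorphyRing K, l.1 (a : K) = ((f a : ℝ) : OnePoint ℝ) := by
  obtain ⟨_, P, rfl⟩ := l
  obtain ⟨f, hf⟩ := exists_ringHom_of_order P
  refine ⟨f, hf, fun g hg => DFunLike.ext _ _ fun a => ?_⟩
  exact OnePoint.coe_injective ((hg a).symm.trans (hf a))

/-- The map `res : M(K) → Hom(H(K), ℝ)`, `λ ↦ λ|_{H(K)}`. -/
def res (K : Type*) [Field K] (l : PlaceSpace K) : RealHom (realHolomorphyRing K) :=
  l.existsUnique_restriction.choose

end RealPlaces

end

/-!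
The central point is that every point `α` of the real spectrum of the real holomorphy ring `H` of
`K` is a specialization of the trace `P ∩ H` of an order `P` of `K` (`exists_speri_le`). For this it
suffices that the elements positive at `α` and the squares of `K` generate a proper preordering of
`K`, that is, that a relation `∑ kᵢ² sᵢ = 0` with all `sᵢ ∈ H` positive at `α` is trivial. A sum of
squares that contains `1` is a unit in every real valuation ring, so all `kᵢ kⱼ / D` with
`D = ∑ kₗ²` lie in `H`; hence the coefficients `kᵢ² / D = ∑ⱼ (kᵢ kⱼ / D)²` are sums of squares in
`H` with sum `1`, and the relation divided by `D` is impossible at `α`.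

It follows that the minimal points are exactly the traces `P ∩ H`. The order `P` is recovered from
its trace, since `a` and `a / (1 + a²) ∈ H` have the same sign; this gives the homeomorphism
`speri`. The homomorphism `λ_P|_H` is nonnegative on `P ∩ H`, so `j (λ_P|_H)` is the unique maximal
specialization of `P ∩ H`. This is the commutativity of the diagram, and it also shows that `res`
and `j` are surjective, because each maximal point, in particular `j φ` for each `φ : H → ℝ`, lies
above some `P ∩ H`. Both maps are injective: a place is determined by its values at `1 / (1 + a²)`
and `a / (1 + a²)`, and a homomorphism to `ℝ` by its sign.

The rest is topology. The space of orders is compact and Hausdorff, `P ↦ λ_P` is continuous, and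
places, homomorphisms and maximal points form Hausdorff spaces, so all continuous bijections
involved are homeomorphisms and all continuous surjections are quotient maps.
-/

namespace RealPlaces

/-! ### Orders of fields -/

/-- A preordering of a field that is maximal for inclusion is an order: if `-x ∉ T`, the
preordering `T + x T` is proper, since `-1 = a + b x` would give `-x = (1 + a) b (b⁻¹)²`. -/
theorem mem_or_neg_mem_of_isMax {K : Type*} [Field K] {T : RingPreordering K} (hT : IsMax T)
    (x : K) : x ∈ T ∨ -x ∈ T := by
  by_contra! h
  obtain ⟨hx, hnx⟩ := h
  let U : RingPreordering K := RingPreordering.mk' {y | ∃ a ∈ T, ∃ b ∈ T, y = a + b * x}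
    (by
      rintro _ _ ⟨a, ha, b, hb, rfl⟩ ⟨c, hc, d, hd, rfl⟩
      exact ⟨a + c, add_mem ha hc, b + d, add_mem hb hd, by ring⟩)
    (by
      rintro _ _ ⟨a, ha, b, hb, rfl⟩ ⟨c, hc, d, hd, rfl⟩
      exact ⟨a * c + b * d * (x * x),
        add_mem (mul_mem ha hc) (mul_mem (mul_mem hb hd) (T.mul_self_mem x)),
        a * d + b * c, add_mem (mul_mem ha hd) (mul_mem hb hc), by ring⟩)
    (fun y => ⟨y * y, T.mul_self_mem y, 0, zero_mem T, by ring⟩)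
    (by
      rintro ⟨a, ha, b, hb, h⟩
      have hb0 : b ≠ 0 := by
        rintro rfl
        exact T.neg_one_notMem (by simpa [h] using ha)
      refine hnx ?_
      have : -x = (1 + a) * b * (b⁻¹ * b⁻¹) := by
        field_simp
        linear_combination h
      rw [this]
      exact mul_mem (mul_mem (add_mem (one_mem T) ha) hb) (T.mul_self_mem _))
  have hle : T ≤ U := fun y hy => ⟨y, hy, 0, zero_mem T, by ring⟩
  exact hx (hT hle ⟨0, zero_mem T, 1, one_mem T, by ring⟩)

/-- Every preordering of a field is contained in an order. -/
theorem exists_order_ge {K : Type*} [Field K] (T : RingPreordering K) :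
    ∃ P : OrderSpace K, T ≤ P.1 := by
  obtain ⟨M, hTM, hM⟩ := zorn_le_nonempty_Ici₀ T (by
    intro c _ hc y hy
    have key : ∀ {a b : K}, (∃ Q ∈ c, a ∈ Q) → (∃ Q ∈ c, b ∈ Q) → ∃ Q ∈ c, a ∈ Q ∧ b ∈ Q := by
      rintro a b ⟨Q, hQ, ha⟩ ⟨R, hR, hb⟩
      rcases hc.total hQ hR with h | h
      · exact ⟨R, hR, h ha, hb⟩
      · exact ⟨Q, hQ, ha, h hb⟩
    refine ⟨RingPreordering.mk' {a | ∃ Q ∈ c, a ∈ Q} ?_ ?_ ?_ ?_, fun Q hQ a ha => ⟨Q, hQ, ha⟩⟩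
    · intro a b ha hb
      obtain ⟨Q, hQ, ha, hb⟩ := key ha hb
      exact ⟨Q, hQ, add_mem ha hb⟩
    · intro a b ha hb
      obtain ⟨Q, hQ, ha, hb⟩ := key ha hb
      exact ⟨Q, hQ, mul_mem ha hb⟩
    · exact fun a => ⟨y, hy, y.mul_self_mem a⟩
    · rintro ⟨Q, -, h⟩
      exact Q.neg_one_notMem h) T le_rfl
  exact ⟨⟨M, ⟨mem_or_neg_mem_of_isMax hM⟩⟩, hTM⟩

theorem OrderSpace.mem_or_neg_mem {K : Type*} [Field K] (P : OrderSpace K) (a : K) :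
    a ∈ P.1 ∨ -a ∈ P.1 :=
  P.2.mem_or_neg_mem a

theorem OrderSpace.neg_notMem_iff {K : Type*} [Field K] (P : OrderSpace K) {a : K} (ha : a ≠ 0) :
    -a ∉ P.1 ↔ a ∈ P.1 :=
  ⟨(P.mem_or_neg_mem a).resolve_right,
    fun h h' => ha (P.1.eq_zero_of_mem_of_neg_mem h h')⟩

theorem OrderSpace.isOpen_setOf_mem {K : Type*} [Field K] (a : K) :
    IsOpen {P : OrderSpace K | a ∈ P.1} :=
  TopologicalSpace.isOpen_generateFrom_of_mem ⟨a, rfl⟩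

instance (K : Type*) [Field K] : T2Space (OrderSpace K) := by
  refine ⟨fun P Q hPQ => ?_⟩
  have : ∃ a ∈ P.1, a ∉ Q.1 := by
    by_contra! h
    refine hPQ (Subtype.ext (SetLike.ext fun a => ⟨h a, fun ha => ?_⟩))
    by_contra ha'
    have h1 := (P.mem_or_neg_mem a).resolve_left ha'
    have h0 := Q.1.eq_zero_of_mem_of_neg_mem ha (h _ h1)
    exact ha' (h0 ▸ zero_mem P.1)
  obtain ⟨a, haP, haQ⟩ := this
  refine ⟨_, _, OrderSpace.isOpen_setOf_mem a, OrderSpace.isOpen_setOf_mem (-a), haP,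
    (Q.mem_or_neg_mem a).resolve_left haQ, ?_⟩
  rw [Set.disjoint_left]
  intro R h1 h2
  have h0 := R.1.eq_zero_of_mem_of_neg_mem h1 h2
  exact haQ (h0 ▸ zero_mem Q.1)

/-- An ultrafilter `F` on the space of orders converges to the order formed by the elements that
belong to `F`-almost every order. -/
instance (K : Type*) [Field K] : CompactSpace (OrderSpace K) := by
  refine ⟨isCompact_iff_ultrafilter_le_nhds.2 fun F _ => ?_⟩
  let P : OrderSpace K := ⟨RingPreordering.mk' {a | ∀ᶠ Q : OrderSpace K in F, a ∈ Q.1}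
    (fun ha hb => by filter_upwards [ha, hb] with Q h1 h2 using add_mem h1 h2)
    (fun ha hb => by filter_upwards [ha, hb] with Q h1 h2 using mul_mem h1 h2)
    (fun a => Filter.Eventually.of_forall fun Q => Q.1.mul_self_mem a)
    (fun h => by
      obtain ⟨Q, hQ⟩ := h.exists
      exact Q.1.neg_one_notMem hQ),
    ⟨fun a => Ultrafilter.eventually_or.1
      (Filter.Eventually.of_forall fun Q : OrderSpace K => Q.mem_or_neg_mem a)⟩⟩
  refine ⟨P, Set.mem_univ _, ?_⟩
  rw [TopologicalSpace.nhds_generateFrom]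
  refine le_iInf₂ fun s hs => ?_
  obtain ⟨hPs, a, rfl⟩ := hs
  exact Filter.le_principal_iff.2 hPs

/-! ### Elements of the real holomorphy ring -/

/-- In a real valuation ring a sum of squares with a summand `1` is a unit, because `-1` is not a
sum of squares in the residue field. -/
theorem IsRealValuationRing.isUnit_sum_sq {K : Type*} [Field K] {A : ValuationSubring K}
    (hA : IsRealValuationRing A) {ι : Type*} [Fintype ι] (y : ι → A) (i : ι) (hi : y i = 1) :
    IsUnit (∑ l, y l * y l) := by
  classical
  obtain ⟨P⟩ := hA
  rw [← IsLocalRing.residue_ne_zero_iff_isUnit]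
  intro h
  rw [← Finset.add_sum_erase _ _ (Finset.mem_univ i), hi, map_add, map_sum] at h
  simp only [map_mul, map_one, mul_one] at h
  refine P.1.neg_one_notMem ?_
  rw [neg_eq_of_add_eq_zero_right h]
  exact sum_mem fun l _ => P.1.mul_self_mem _

/-- A family with a nonzero entry is normalized by dividing it by an entry of greatest value. -/
theorem IsRealValuationRing.exists_sum_sq_eq {K : Type*} [Field K] {A : ValuationSubring K}
    (hA : IsRealValuationRing A) {ι : Type*} [Fintype ι] (k : ι → K) (hk : ∃ i, k i ≠ 0) :
    ∃ (c : K) (y : ι → A), c ≠ 0 ∧ (∀ l, k l = c * y l) ∧ IsUnit (∑ l, y l * y l) := by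
  obtain ⟨i₀, hi₀⟩ := hk
  have : Nonempty ι := ⟨i₀⟩
  -- `c` is an entry of greatest value
  obtain ⟨i, hi⟩ := Finite.exists_max fun l => A.valuation (k l)
  have hc : k i ≠ 0 := by
    intro h
    have := hi i₀
    rw [h, map_zero] at this
    exact hi₀ ((map_eq_zero _).1 (le_zero_iff.1 this))
  have hmem : ∀ l, k l / k i ∈ A := fun l => by
    rw [← A.valuation_le_one_iff, map_div₀]
    exact div_le_one_of_le₀ (hi l) zero_le
  refine ⟨k i, fun l => ⟨k l / k i, hmem l⟩, hc, fun l => (mul_div_cancel₀ _ hc).symm,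
    hA.isUnit_sum_sq _ i (Subtype.ext (div_self hc))⟩

theorem IsRealValuationRing.sum_sq_ne_zero {K : Type*} [Field K] {A : ValuationSubring K}
    (hA : IsRealValuationRing A) {ι : Type*} [Fintype ι] (k : ι → K) (hk : ∃ i, k i ≠ 0) :
    ∑ l, k l * k l ≠ 0 := by
  obtain ⟨c, y, hc, hy, hu⟩ := hA.exists_sum_sq_eq k hk
  have : ∑ l, k l * k l = c * c * ((∑ l, y l * y l : A) : K) := by
    push_cast
    rw [Finset.mul_sum]
    exact Finset.sum_congr rfl fun l _ => by rw [hy]; ring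
  rw [this]
  exact mul_ne_zero (mul_ne_zero hc hc) fun h => hu.ne_zero (Subtype.ext h)

/-- This also holds when the sum of squares vanishes, the quotient being zero then. -/
theorem mul_div_sum_sq_mem_realHolomorphyRing {K : Type*} [Field K] {ι : Type*} [Fintype ι]
    (k : ι → K) (i i' : ι) : k i * k i' / ∑ l, k l * k l ∈ realHolomorphyRing K := by
  refine Subring.mem_iInf.2 fun ⟨A, hA⟩ => ?_
  change _ ∈ A
  by_cases hk : k i = 0
  · rw [hk, zero_mul, zero_div]
    exact zero_mem A
  obtain ⟨c, y, hc, hy, hu⟩ := hA.exists_sum_sq_eq k ⟨i, hk⟩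
  obtain ⟨u, hu⟩ := hu
  have hsum : ∑ l, k l * k l = c * c * ((u : A) : K) := by
    rw [hu]
    push_cast
    rw [Finset.mul_sum]
    exact Finset.sum_congr rfl fun l _ => by rw [hy]; ring
  have h1 : ((u : A) : K) * ((u⁻¹ : Aˣ) : A) = 1 := by
    exact_mod_cast congrArg (Subtype.val) u.mul_inv
  have hu0 : ((u : A) : K) ≠ 0 := left_ne_zero_of_mul_eq_one h1
  have : k i * k i' / ∑ l, k l * k l = ((y i * y i' * (u⁻¹ : Aˣ) : A) : K) := by
    rw [hsum, hy i, hy i']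
    push_cast
    rw [div_eq_iff (mul_ne_zero (mul_ne_zero hc hc) hu0)]
    linear_combination (-(c * c * y i * y i' : K)) * h1
  rw [this]
  exact Subtype.property _

theorem inv_one_add_sq_mem_realHolomorphyRing {K : Type*} [Field K] (a : K) :
    (1 + a * a)⁻¹ ∈ realHolomorphyRing K := by
  simpa using mul_div_sum_sq_mem_realHolomorphyRing ![1, a] 0 0

theorem mul_inv_one_add_sq_mem_realHolomorphyRing {K : Type*} [Field K] (a : K) :
    a * (1 + a * a)⁻¹ ∈ realHolomorphyRing K := by
  simpa [div_eq_mul_inv] using mul_div_sum_sq_mem_realHolomorphyRing ![1, a] 1 0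

/-! ### Orders of the field below a point of the real spectrum -/

theorem RealSpectrum.neg_mul_notMem {R : Type*} [CommRing R] (α : RealSpectrum R) {s t : R}
    (hs : -s ∉ α.1) (ht : -t ∉ α.1) : -(s * t) ∉ α.1 := by
  have := α.2
  intro h
  have hs' := (α.mem_or_neg_mem s).resolve_right hs
  have ht' := (α.mem_or_neg_mem t).resolve_right ht
  have hst : s * t ∈ α.1.support := ⟨mul_mem hs' ht', h⟩
  rcases Ideal.IsPrime.mem_or_mem inferInstance hst with h | h
  · exact hs h.2
  · exact ht h.2

/-- At a point where all `s i` are positive, a vanishing sum `∑ u i * s i` with nonnegative `u i`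
forces every `u i` into the support, which does not contain `∑ u i = 1`. -/
theorem RealSpectrum.sum_mul_ne_zero {R : Type*} [CommRing R] (α : RealSpectrum R)
    {ι : Type*} [Fintype ι] (u s : ι → R) (hu : ∀ i, u i ∈ α.1) (hu1 : ∑ i, u i = 1)
    (hs : ∀ i, -s i ∉ α.1) : ∑ i, u i * s i ≠ 0 := by
  classical
  have := α.2
  intro h
  have hmem : ∀ i, u i * s i ∈ α.1 := fun i =>
    mul_mem (hu i) ((α.mem_or_neg_mem _).resolve_right (hs i))
  have hsupp : ∀ i, u i ∈ α.1.support := by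
    intro i
    rw [← Finset.add_sum_erase _ _ (Finset.mem_univ i)] at h
    have h1 : u i * s i ∈ α.1.support := by
      refine ⟨hmem i, ?_⟩
      change -(u i * s i) ∈ α.1
      rw [neg_eq_of_add_eq_zero_right h]
      exact sum_mem fun l _ => hmem l
    exact (Ideal.IsPrime.mem_or_mem inferInstance h1).resolve_right fun h => hs i h.2
  exact α.1.one_notMem_support (hu1 ▸ sum_mem fun i _ => hsupp i)

/-- The key independence statement: dividing by `∑ k i ^ 2` turns a relation over `K` into a
relation over the real holomorphy ring whose coefficients are sums of squares with sum `1`. -/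
theorem sum_sq_mul_ne_zero {K : Type*} [Field K] (α : RealSpectrum (realHolomorphyRing K))
    {ι : Type*} [Fintype ι] (k : ι → K) (hk : ∃ i, k i ≠ 0) (s : ι → realHolomorphyRing K)
    (hs : ∀ i, -s i ∉ α.1) : ∑ i, k i * k i * (s i : K) ≠ 0 := by
  intro h
  by_cases hD : ∑ l, k l * k l = 0
  · -- then `K` has no real valuation ring, and the real holomorphy ring is all of `K`
    have hall : ∀ x : K, x ∈ realHolomorphyRing K := fun x =>
      Subring.mem_iInf.2 fun ⟨A, hA⟩ => absurd hD (hA.sum_sq_ne_zero k hk)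
    obtain ⟨i, hi⟩ := hk
    let y : ι → realHolomorphyRing K := fun l => ⟨k l / k i, hall _⟩
    classical
    have h0 : ∑ l, y l * y l = 0 := by
      refine Subtype.ext ?_
      have : ((∑ l, y l * y l : realHolomorphyRing K) : K)
          = (∑ l, k l * k l) * ((k i)⁻¹ * (k i)⁻¹) := by
        push_cast
        rw [Finset.sum_mul]
        exact Finset.sum_congr rfl fun l _ => by simp only [y]; ring
      rw [this, hD, zero_mul]
      rfl
    rw [← Finset.add_sum_erase _ _ (Finset.mem_univ i)] at h0
    have hyi : y i = 1 := Subtype.ext (div_self hi)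
    rw [hyi, mul_one] at h0
    refine α.1.neg_one_notMem ?_
    rw [neg_eq_of_add_eq_zero_right h0]
    exact sum_mem fun l _ => α.1.mul_self_mem _
  · let D := ∑ l, k l * k l
    let w : ι → ι → realHolomorphyRing K :=
      fun i l => ⟨k i * k l / D, mul_div_sum_sq_mem_realHolomorphyRing k i l⟩
    have hw : ∀ i, ∑ l, w i l * w i l = w i i := by
      intro i
      refine Subtype.ext ?_
      push_cast
      have : ∀ l, (w i l : K) * w i l = k i * k i / (D * D) * (k l * k l) := fun l => by
        simp only [w]
        ring
      simp only [this]
      rw [← Finset.mul_sum]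
      change k i * k i / (D * D) * D = k i * k i / D
      have hD' : D ≠ 0 := hD
      field_simp
    refine α.sum_mul_ne_zero (fun i => w i i) s (fun i => ?_) ?_ hs ?_
    · rw [← hw]
      exact sum_mem fun l _ => α.1.mul_self_mem _
    · refine Subtype.ext ?_
      push_cast
      simp only [w]
      rw [← Finset.sum_div]
      exact div_self hD
    · refine Subtype.ext ?_
      push_cast
      have : ∀ i, (w i i : K) * s i = k i * k i * s i / D := fun i => by
        simp only [w]
        ring
      simp only [this]
      rw [← Finset.sum_div, h, zero_div]

/-- Every point of the real spectrum of the real holomorphy ring is a specialization of the trace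
of an order of the field: the elements positive at `α`, together with the squares of `K`, generate
a proper preordering. -/
theorem exists_speri_le {K : Type*} [Field K] (α : RealSpectrum (realHolomorphyRing K)) :
    ∃ P : OrderSpace K, (speri K P).1 ≤ α := by
  let M : Submonoid K :=
    { carrier := {x | ∃ k : K, ∃ s : realHolomorphyRing K, -s ∉ α.1 ∧ x = k * k * s}
      one_mem' := ⟨1, 1, α.1.neg_one_notMem, by simp⟩
      mul_mem' := by
        rintro _ _ ⟨k, s, hs, rfl⟩ ⟨l, t, ht, rfl⟩
        exact ⟨k * l, s * t, α.neg_mul_notMem hs ht, by push_cast; ring⟩ }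
  have hsum : ∀ x ∈ M.subsemiringClosure, ∃ (ι : Type) (_ : Fintype ι) (k : ι → K)
      (s : ι → realHolomorphyRing K), (∀ i, -s i ∉ α.1) ∧ x = ∑ i, k i * k i * (s i : K) := by
    intro x hx
    rw [← SetLike.mem_coe, Submonoid.subsemiringClosure_coe, SetLike.mem_coe] at hx
    induction hx using AddSubmonoid.closure_induction with
    | mem x hx =>
      obtain ⟨k, s, hs, rfl⟩ := hx
      exact ⟨Unit, inferInstance, fun _ => k, fun _ => s, fun _ => hs, by simp⟩
    | zero => exact ⟨Empty, inferInstance, Empty.elim, Empty.elim, fun i => i.elim, by simp⟩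
    | add x y _ _ hx hy =>
      obtain ⟨ι, _, k, s, hs, rfl⟩ := hx
      obtain ⟨ι', _, k', s', hs', rfl⟩ := hy
      exact ⟨ι ⊕ ι', inferInstance, Sum.elim k k', Sum.elim s s',
        fun i => by cases i <;> simp [hs, hs'], by simp⟩
  have hM : ∀ x ∈ M, x ∈ M.subsemiringClosure := fun x hx => by
    rw [Submonoid.subsemiringClosure_mem]
    exact AddSubmonoid.subset_closure hx
  let T : RingPreordering K := RingPreordering.mk' (M.subsemiringClosure : Set K)
    (fun ha hb => add_mem (S := Subsemiring K) ha hb)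
    (fun ha hb => mul_mem (S := Subsemiring K) ha hb)
    (fun x => hM _ ⟨x, 1, α.1.neg_one_notMem, by simp⟩)
    (by
      intro h
      obtain ⟨ι, _, k, s, hs, h⟩ := hsum _ h
      refine sum_sq_mul_ne_zero α (ι := Option ι) (fun i => i.elim 1 k) ⟨none, by simp⟩
        (fun i => i.elim 1 s) (fun i => ?_) ?_
      · cases i with
        | none => exact α.1.neg_one_notMem
        | some i => exact hs i
      · simp [Fintype.sum_option, ← h])
  obtain ⟨P, hP⟩ := exists_order_ge T
  refine ⟨P, fun a ha => ?_⟩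
  by_contra ha'
  have h1 : ((-a : realHolomorphyRing K) : K) ∈ P.1 :=
    hP (hM _ ⟨1, -a, by simpa using ha', by simp⟩)
  have h0 : (a : K) = 0 := P.1.eq_zero_of_mem_of_neg_mem ha (by simpa using h1)
  have : a = 0 := Subtype.ext h0
  exact ha' (this ▸ zero_mem α.1)

/-! ### The real places of an ordered field -/

/-- Every order is the set of nonnegative elements for a structure of ordered field, so that
statements about orders may be proved in an ordered field. -/
theorem OrderSpace.induction_linearOrder {K : Type*} [Field K] {motive : OrderSpace K → Prop}
    (h : ∀ [LinearOrder K] [IsOrderedRing K], motive (orderOfLinearOrder K)) (P : OrderSpace K) :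
    motive P := by
  let := P.linearOrder
  have := P.isOrderedRing
  have hP : orderOfLinearOrder K = P := by
    refine Subtype.ext (SetLike.ext fun a => ?_)
    change a - 0 ∈ P.1 ↔ a ∈ P.1
    rw [sub_zero]
  exact hP ▸ h

section LinearOrder

variable {K : Type*} [Field K] [LinearOrder K] [IsOrderedRing K]

theorem mem_orderOfLinearOrder {a : K} : a ∈ (orderOfLinearOrder K).1 ↔ 0 ≤ a := Iff.rfl

theorem orderOfLinearOrder_le {a b : K} : (orderOfLinearOrder K).le a b ↔ a ≤ b := by
  rw [OrderSpace.le, mem_orderOfLinearOrder, sub_nonneg]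

theorem mem_A_orderOfLinearOrder {a : K} :
    a ∈ (orderOfLinearOrder K).A ↔ 0 ≤ ArchimedeanClass.mk a := by
  simp only [OrderSpace.A, Set.mem_ofPred_eq, orderOfLinearOrder_le]
  constructor
  · rintro ⟨r, h1, h2⟩
    exact (ArchimedeanClass.mk_ratCast_nonneg r).trans
      (ArchimedeanClass.mk_le_mk_of_abs ((abs_le.2 ⟨h1, h2⟩).trans (le_abs_self _)))
  · intro h
    obtain ⟨n, hn⟩ := ArchimedeanClass.exists_nat_ge_of_mk_nonneg h
    obtain ⟨m, hm⟩ := ArchimedeanClass.exists_nat_ge_of_mk_nonneg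
      (x := -a) (by rwa [ArchimedeanClass.mk_neg])
    have hn0 : (0 : K) ≤ n := Nat.cast_nonneg n
    have hm0 : (0 : K) ≤ m := Nat.cast_nonneg m
    refine ⟨(n + m : ℕ), ?_, ?_⟩ <;> push_cast <;> linarith

open Classical in
theorem place_orderOfLinearOrder (a : K) :
    (orderOfLinearOrder K).place a = if 0 ≤ ArchimedeanClass.mk a then
      ((ArchimedeanClass.stdPart a : ℝ) : OnePoint ℝ) else OnePoint.infty := by
  rw [OrderSpace.place]
  simp only [mem_A_orderOfLinearOrder, orderOfLinearOrder_le]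
  split_ifs with ha
  · congr 1
    have hmem : ∀ r : ℚ, ArchimedeanClass.stdPart a < r → a ≤ r := by
      intro r hr
      by_contra! h
      have := ArchimedeanClass.stdPart_monotoneOn (ArchimedeanClass.mk_ratCast_nonneg r) ha h.le
      rw [ArchimedeanClass.stdPart_ratCast] at this
      exact absurd hr (not_lt.2 this)
    refine csInf_eq_of_forall_ge_of_forall_gt_exists_lt ?_ ?_ ?_
    · obtain ⟨r, hr⟩ := exists_rat_gt (ArchimedeanClass.stdPart a)
      exact ⟨r, r, rfl, hmem r hr⟩
    · rintro _ ⟨r, rfl, hr⟩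
      simpa using
        ArchimedeanClass.stdPart_monotoneOn ha (ArchimedeanClass.mk_ratCast_nonneg r) hr
    · intro w hw
      obtain ⟨r, hr, hr'⟩ := exists_rat_btwn hw
      exact ⟨r, ⟨r, rfl, hmem r hr⟩, hr'⟩
  · rfl

end LinearOrder

theorem OrderSpace.place_eq_infty_iff {K : Type*} [Field K] (P : OrderSpace K) (a : K) :
    P.place a = OnePoint.infty ↔ a ∉ P.A := by
  classical
  rw [OrderSpace.place]
  split_ifs with h <;> simp [h]

theorem OrderSpace.le_of_ratCast_le {K : Type*} [Field K] (P : OrderSpace K) {a : K} {x : ℝ}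
    (hx : P.place a = x) {r : ℚ} (hr : P.le r a) : r ≤ x := by
  classical
  induction P using OrderSpace.induction_linearOrder with | h =>
  rw [place_orderOfLinearOrder] at hx
  split_ifs at hx with ha
  · rw [← OnePoint.coe_injective hx]
    simpa using ArchimedeanClass.stdPart_monotoneOn (ArchimedeanClass.mk_ratCast_nonneg r) ha
      (orderOfLinearOrder_le.1 hr)
  · exact absurd hx (OnePoint.infty_ne_coe x)

theorem OrderSpace.le_of_le_ratCast {K : Type*} [Field K] (P : OrderSpace K) {a : K} {x : ℝ}
    (hx : P.place a = x) {r : ℚ} (hr : P.le a r) : x ≤ r := by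
  classical
  induction P using OrderSpace.induction_linearOrder with | h =>
  rw [place_orderOfLinearOrder] at hx
  split_ifs at hx with ha
  · rw [← OnePoint.coe_injective hx]
    simpa using ArchimedeanClass.stdPart_monotoneOn ha (ArchimedeanClass.mk_ratCast_nonneg r)
      (orderOfLinearOrder_le.1 hr)
  · exact absurd hx (OnePoint.infty_ne_coe x)

theorem OrderSpace.le_total {K : Type*} [Field K] (P : OrderSpace K) (a b : K) :
    P.le a b ∨ P.le b a := by
  simpa [OrderSpace.le] using P.mem_or_neg_mem (b - a)

theorem OrderSpace.ratCast_le_ratCast {K : Type*} [Field K] (P : OrderSpace K) {r s : ℚ}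
    (h : r ≤ s) : P.le r s := by
  induction P using OrderSpace.induction_linearOrder with | h =>
  rw [orderOfLinearOrder_le]
  exact_mod_cast h

theorem OrderSpace.le_trans {K : Type*} [Field K] (P : OrderSpace K) {a b c : K}
    (h : P.le a b) (h' : P.le b c) : P.le a c := by
  simpa [OrderSpace.le] using add_mem (S := RingPreordering K) h h'

theorem OrderSpace.mem_A_of_le_of_le {K : Type*} [Field K] (P : OrderSpace K) {a : K} {r s : ℚ}
    (hr : P.le r a) (hs : P.le a s) : a ∈ P.A := by
  refine ⟨max |r| |s|, ?_, P.le_trans hs (P.ratCast_le_ratCast ?_)⟩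
  · have := P.ratCast_le_ratCast (r := -max |r| |s|) (s := r)
      (neg_le.1 ((neg_le_abs r).trans (le_max_left _ _)))
    push_cast at this ⊢
    exact P.le_trans this hr
  · exact (le_abs_self s).trans (le_max_right _ _)

/-- Each place is determined by its restriction to the real holomorphy ring, as the quotient of
the values of `a / (1 + a²)` and `1 / (1 + a²)`. -/
theorem OrderSpace.exists_place_eq_div {K : Type*} [Field K] (P : OrderSpace K) (a : K) :
    ∃ x y : ℝ, P.place (1 + a * a)⁻¹ = x ∧ P.place (a * (1 + a * a)⁻¹) = y ∧
      P.place a = if x = 0 then OnePoint.infty else ((y / x : ℝ) : OnePoint ℝ) := by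
  classical
  induction P using OrderSpace.induction_linearOrder with | h =>
  have hpos : 0 < 1 + a * a := by nlinarith [mul_self_nonneg a]
  have bdd : ∀ b : K, |b| ≤ 1 → 0 ≤ ArchimedeanClass.mk b := fun b hb => by
    rw [← ArchimedeanClass.mk_one, ArchimedeanClass.mk_le_mk]
    exact ⟨1, by simpa using hb⟩
  have hu : 0 ≤ ArchimedeanClass.mk (1 + a * a)⁻¹ := by
    refine bdd _ ?_
    rw [abs_of_pos (inv_pos.2 hpos)]
    exact inv_le_one_of_one_le₀ (by nlinarith [mul_self_nonneg a])
  have hv : 0 ≤ ArchimedeanClass.mk (a * (1 + a * a)⁻¹) := by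
    refine bdd _ ?_
    rw [abs_mul, abs_of_pos (inv_pos.2 hpos), ← div_eq_mul_inv, div_le_one hpos]
    nlinarith [abs_mul_abs_self a, sq_nonneg (|a| - 1), abs_nonneg a]
  refine ⟨ArchimedeanClass.stdPart (1 + a * a)⁻¹,
    ArchimedeanClass.stdPart (a * (1 + a * a)⁻¹), ?_, ?_, ?_⟩
  · rw [place_orderOfLinearOrder, if_pos hu]
  · rw [place_orderOfLinearOrder, if_pos hv]
  · rw [place_orderOfLinearOrder]
    split_ifs with ha hx hx
    · rw [ArchimedeanClass.stdPart_inv, ArchimedeanClass.stdPart_add (by simp)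
        (by rw [ArchimedeanClass.mk_mul]; exact add_nonneg ha ha),
        ArchimedeanClass.stdPart_mul ha ha, ArchimedeanClass.stdPart_one, inv_eq_zero] at hx
      nlinarith [mul_self_nonneg (ArchimedeanClass.stdPart a)]
    · rw [ArchimedeanClass.stdPart_mul ha hu, mul_div_cancel_right₀ _ hx]
    · rfl
    · -- if `a` is infinite then `1 / (1 + a²)` is infinitesimal
      refine absurd ?_ hx
      rw [ArchimedeanClass.stdPart_inv, ArchimedeanClass.stdPart_of_mk_ne_zero, inv_zero]
      intro h0
      refine ha (h0 ▸ ArchimedeanClass.mk_le_mk_of_abs ?_)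
      rw [abs_of_pos hpos]
      nlinarith [abs_mul_abs_self a, sq_nonneg (|a| - 1), abs_nonneg a]

/-! ### Topology of the space of real places -/

instance (K : Type*) [Field K] : T2Space (PlaceSpace K) := by
  refine T2Space.of_injective_continuous (f := fun (l : PlaceSpace K) (a : K) => l.1 a)
    (fun l m h => Subtype.ext h) (continuous_pi fun a => ?_)
  exact continuous_iInf_dom continuous_induced_dom

instance (R : Type*) [CommRing R] : T2Space (RealHom R) := by
  refine T2Space.of_injective_continuous (f := fun (φ : RealHom R) (a : R) => φ a)
    DFunLike.coe_injective (continuous_pi fun a => ?_)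
  exact continuous_iInf_dom continuous_induced_dom

theorem RealHom.continuous_eval {R : Type*} [CommRing R] (a : R) :
    Continuous fun φ : RealHom R => φ a :=
  continuous_iInf_dom continuous_induced_dom

/-- The conditions `r ≤_P a` and `a ≤_P r` on `P` are open, and confine `λ_P a` to a closed
half-line. -/
theorem OrderSpace.continuous_place {K : Type*} [Field K] (a : K) :
    Continuous fun P : OrderSpace K => P.place a := by
  refine continuous_iff_continuousAt.2 fun P => ?_
  have hopen : ∀ b c : K, P.le b c → ∀ᶠ Q in 𝓝 P, Q.le b c := fun b c h =>
    (OrderSpace.isOpen_setOf_mem (c - b)).mem_nhds h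
  rw [ContinuousAt]
  by_cases ha : a ∈ P.A
  · obtain ⟨x, hx⟩ := OnePoint.ne_infty_iff_exists.1
      (mt (P.place_eq_infty_iff a).1 (not_not.2 ha))
    rw [← hx, OnePoint.nhds_coe_eq]
    intro U hU
    obtain ⟨ε, hε, hball⟩ := Metric.mem_nhds_iff.1 (Filter.mem_map.1 hU)
    obtain ⟨r, hr, hrx⟩ := exists_rat_btwn (sub_lt_self x hε)
    obtain ⟨s, hxs, hs⟩ := exists_rat_btwn (lt_add_of_pos_right x hε)
    have h1 : P.le r a := (P.le_total r a).resolve_right fun h =>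
      absurd (P.le_of_le_ratCast hx.symm h) (not_le.2 hrx)
    have h2 : P.le a s := (P.le_total a s).resolve_right fun h =>
      absurd (P.le_of_ratCast_le hx.symm h) (not_le.2 hxs)
    rw [Filter.mem_map]
    filter_upwards [hopen _ _ h1, hopen _ _ h2] with Q hQ1 hQ2
    obtain ⟨y, hy⟩ := OnePoint.ne_infty_iff_exists.1
      (mt (Q.place_eq_infty_iff a).1 (not_not.2 (Q.mem_A_of_le_of_le hQ1 hQ2)))
    rw [Set.mem_preimage, ← hy]
    have h3 := Q.le_of_ratCast_le hy.symm hQ1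
    have h4 := Q.le_of_le_ratCast hy.symm hQ2
    refine hball ?_
    rw [Metric.mem_ball, Real.dist_eq, abs_lt]
    constructor <;> linarith
  · rw [(P.place_eq_infty_iff a).2 ha]
    refine OnePoint.hasBasis_nhds_infty.tendsto_right_iff.2 ?_
    rintro s ⟨-, hs⟩
    obtain ⟨C, hC⟩ := hs.isBounded.subset_closedBall 0
    obtain ⟨n, hn⟩ := exists_nat_gt C
    have hlarge : P.le ((n : ℚ) : K) a ∨ P.le a ((-n : ℚ) : K) := by
      by_contra! h
      exact ha (P.mem_A_of_le_of_le ((P.le_total _ _).resolve_left h.2)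
        ((P.le_total _ _).resolve_left h.1))
    have hev : ∀ᶠ Q in 𝓝 P, Q.le ((n : ℚ) : K) a ∨ Q.le a ((-n : ℚ) : K) := by
      rcases hlarge with h | h
      · exact (hopen _ _ h).mono fun Q => Or.inl
      · exact (hopen _ _ h).mono fun Q => Or.inr
    filter_upwards [hev] with Q hQ
    by_cases hQa : Q.place a = OnePoint.infty
    · exact Or.inr hQa
    obtain ⟨y, hy⟩ := OnePoint.ne_infty_iff_exists.1 hQa
    refine Or.inl ⟨y, fun hys => ?_, hy⟩
    have hyC := hC hys
    rw [mem_closedBall_zero_iff, Real.norm_eq_abs, abs_le] at hyC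
    rcases hQ with h | h
    · have := Q.le_of_ratCast_le hy.symm h
      push_cast at this
      linarith
    · have := Q.le_of_le_ratCast hy.symm h
      push_cast at this
      linarith

theorem continuous_Lam (K : Type*) [Field K] : Continuous (Lam K) :=
  continuous_iInf_rng.2 fun a => continuous_induced_rng.2 (OrderSpace.continuous_place a)

theorem surjective_Lam (K : Type*) [Field K] : Function.Surjective (Lam K) := by
  rintro ⟨_, P, rfl⟩
  exact ⟨P, rfl⟩

instance (K : Type*) [Field K] : CompactSpace (PlaceSpace K) :=
  (surjective_Lam K).compactSpace (continuous_Lam K)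

/-! ### Restriction of places to the real holomorphy ring -/

theorem coe_res {K : Type*} [Field K] (l : PlaceSpace K) (a : realHolomorphyRing K) :
    ((res K l a : ℝ) : OnePoint ℝ) = l.1 (a : K) :=
  (l.existsUnique_restriction.choose_spec.1 a).symm

theorem continuous_res (K : Type*) [Field K] : Continuous (res K) := by
  refine continuous_iInf_rng.2 fun a => continuous_induced_rng.2 ?_
  refine OnePoint.isOpenEmbedding_coe.isEmbedding.continuous_iff.2 ?_
  refine (continuous_iInf_dom continuous_induced_dom :
    Continuous fun l : PlaceSpace K => l.1 (a : K)).congr fun l => ?_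
  exact (coe_res l a).symm

theorem injective_res (K : Type*) [Field K] : Function.Injective (res K) := by
  intro l m h
  have hH : ∀ b ∈ realHolomorphyRing K, l.1 b = m.1 b := fun b hb => by
    rw [← coe_res l ⟨b, hb⟩, ← coe_res m ⟨b, hb⟩, h]
  obtain ⟨P, rfl⟩ := surjective_Lam K l
  obtain ⟨Q, rfl⟩ := surjective_Lam K m
  refine Subtype.ext (funext fun a => ?_)
  obtain ⟨x, y, hx, hy, hxy⟩ := P.exists_place_eq_div a
  obtain ⟨x', y', hx', hy', hxy'⟩ := Q.exists_place_eq_div a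
  have h1 : x = x' := OnePoint.coe_injective <| hx.symm.trans <|
    (hH _ (inv_one_add_sq_mem_realHolomorphyRing a)).trans hx'
  have h2 : y = y' := OnePoint.coe_injective <| hy.symm.trans <|
    (hH _ (mul_inv_one_add_sq_mem_realHolomorphyRing a)).trans hy'
  change P.place a = Q.place a
  rw [hxy, hxy', h1, h2]

/-! ### Maximal points of the real spectrum -/

theorem mem_speri {K : Type*} [Field K] {P : OrderSpace K} {a : realHolomorphyRing K} :
    a ∈ (speri K P).1.1 ↔ (a : K) ∈ P.1 := Iff.rfl

theorem mem_j {R : Type*} [CommRing R] {φ : RealHom R} {a : R} :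
    a ∈ (j R φ).1.1 ↔ 0 ≤ φ a := Iff.rfl

theorem le_sp {R : Type*} [CommRing R] (α : MinSper R) : α.1 ≤ (sp R α).1 :=
  α.1.existsUnique_max.choose_spec.1

theorem speri_le_j_res {K : Type*} [Field K] (P : OrderSpace K) :
    (speri K P).1 ≤ (j (realHolomorphyRing K) (res K (Lam K P))).1 := by
  intro a ha
  have h0 : P.le ((0 : ℚ) : K) (a : K) := by
    rw [OrderSpace.le, Rat.cast_zero, sub_zero]
    exact ha
  have := P.le_of_ratCast_le (coe_res (Lam K P) a).symm h0
  exact mem_j.2 (by simpa using this)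

theorem sp_speri {K : Type*} [Field K] (P : OrderSpace K) :
    sp (realHolomorphyRing K) (speri K P) = j (realHolomorphyRing K) (res K (Lam K P)) :=
  (speri K P).1.existsUnique_max.unique (le_sp _) (speri_le_j_res P)

/-- Each maximal point of the real spectrum of the real holomorphy ring comes from the place of an
order lying below it. -/
theorem exists_j_res_Lam_eq {K : Type*} [Field K] (β : MaxSper (realHolomorphyRing K)) :
    ∃ P : OrderSpace K, j (realHolomorphyRing K) (res K (Lam K P)) = β := by
  obtain ⟨P, hP⟩ := exists_speri_le β.1
  exact ⟨P, (speri K P).1.existsUnique_max.unique (speri_le_j_res P) hP⟩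

/-- A ring homomorphism to `ℝ` is determined by its sign, by comparison with the rationals. -/
theorem injective_j (R : Type*) [CommRing R] : Function.Injective (j R) := by
  have key : ∀ φ ψ : RealHom R, j R φ = j R ψ → ∀ a, ψ a ≤ φ a := by
    intro φ ψ h a
    by_contra! hlt
    obtain ⟨q, hq1, hq2⟩ := exists_rat_btwn hlt
    have hden : (0 : ℝ) < q.den := by exact_mod_cast q.den_pos
    have hq : (q : ℝ) = q.num / q.den := Rat.cast_def q
    rw [hq, lt_div_iff₀ hden] at hq1
    rw [hq, div_lt_iff₀ hden] at hq2
    have h1 : (a * (q.den : R) - (q.num : R)) ∈ (j R ψ).1.1 := mem_j.2 (by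
      rw [map_sub, map_mul, map_natCast, map_intCast]
      linarith)
    rw [← h, mem_j, map_sub, map_mul, map_natCast, map_intCast] at h1
    linarith
  exact fun φ ψ h => DFunLike.ext _ _ fun a => le_antisymm (key ψ φ h.symm a) (key φ ψ h a)

theorem RealSpectrum.isOpen_setOf_neg_notMem {R : Type*} [CommRing R] (a : R) :
    IsOpen {α : RealSpectrum R | -a ∉ α.1} :=
  TopologicalSpace.isOpen_generateFrom_of_mem ⟨a, rfl⟩

theorem continuous_j (R : Type*) [CommRing R] : Continuous (j R) := by
  refine continuous_induced_rng.2 (continuous_generateFrom_iff.2 ?_)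
  rintro _ ⟨a, rfl⟩
  have : ((Subtype.val ∘ j R) ⁻¹' {α : RealSpectrum R | -a ∉ α.1}) = {φ : RealHom R | 0 < φ a} := by
    ext φ
    change -a ∉ (j R φ).1.1 ↔ 0 < φ a
    rw [mem_j, map_neg, neg_nonneg, not_le]
  rw [this]
  exact isOpen_lt continuous_const (RealHom.continuous_eval a)

/-- Two distinct maximal points `β`, `γ` are incomparable: if `b` is nonnegative at `β` only and
`c` is nonnegative at `γ` only, the sign of `b - c` separates them. -/
instance (R : Type*) [CommRing R] : T2Space (MaxSper R) := by
  refine ⟨fun β γ hne => ?_⟩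
  have hex : ∀ β γ : MaxSper R, β ≠ γ → ∃ b ∈ β.1.1, b ∉ γ.1.1 := fun β γ h => by
    by_contra! hle
    have hle : β.1 ≤ γ.1 := hle
    exact h (Subtype.ext (le_antisymm hle (β.2 hle)))
  obtain ⟨b, hbβ, hbγ⟩ := hex β γ hne
  obtain ⟨c, hcγ, hcβ⟩ := hex γ β hne.symm
  refine ⟨Subtype.val ⁻¹' {α : RealSpectrum R | -(b - c) ∉ α.1},
    Subtype.val ⁻¹' {α : RealSpectrum R | -(c - b) ∉ α.1},
    (RealSpectrum.isOpen_setOf_neg_notMem _).preimage continuous_subtype_val,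
    (RealSpectrum.isOpen_setOf_neg_notMem _).preimage continuous_subtype_val,
    fun h => hcβ (by simpa using add_mem h hbβ), fun h => hbγ (by simpa using add_mem h hcγ), ?_⟩
  rw [Set.disjoint_left]
  intro α h1 h2
  rcases α.1.mem_or_neg_mem (b - c) with h | h
  · exact h2 (by simpa using h)
  · exact h1 h

/-! ### The maps of the diagram -/

theorem isHomeomorph_res (K : Type*) [Field K] : IsHomeomorph (res K) := by
  refine isHomeomorph_iff_continuous_bijective.2 ⟨continuous_res K, injective_res K, fun φ => ?_⟩
  obtain ⟨P, hP⟩ := exists_j_res_Lam_eq (j (realHolomorphyRing K) φ)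
  exact ⟨Lam K P, injective_j _ hP⟩

instance (K : Type*) [Field K] : CompactSpace (RealHom (realHolomorphyRing K)) :=
  (isHomeomorph_res K).surjective.compactSpace (isHomeomorph_res K).continuous

theorem isHomeomorph_j (K : Type*) [Field K] : IsHomeomorph (j (realHolomorphyRing K)) := by
  refine isHomeomorph_iff_continuous_bijective.2 ⟨continuous_j _, injective_j _, fun β => ?_⟩
  obtain ⟨P, hP⟩ := exists_j_res_Lam_eq β
  exact ⟨_, hP⟩

theorem OrderSpace.mem_iff_mem_speri {K : Type*} [Field K] (P : OrderSpace K) (a : K) :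
    a ∈ P.1 ↔
      (⟨_, mul_inv_one_add_sq_mem_realHolomorphyRing a⟩ : realHolomorphyRing K) ∈
        (speri K P).1.1 := by
  rw [mem_speri]
  have hpos : 1 + a * a ∈ P.1 := add_mem (one_mem P.1) (P.1.mul_self_mem a)
  have hne : 1 + a * a ≠ 0 := fun h => P.1.neg_one_notMem (by
    rw [neg_eq_of_add_eq_zero_right h]
    exact P.1.mul_self_mem a)
  constructor
  · exact fun h => mul_mem h (RingPreordering.inv_mem hpos)
  · intro h
    have := mul_mem h hpos
    rwa [inv_mul_cancel_right₀ hne] at this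

theorem isHomeomorph_speri (K : Type*) [Field K] : IsHomeomorph (speri K) := by
  have hinj : Function.Injective (speri K) := fun P Q h => by
    refine Subtype.ext (SetLike.ext fun a => ?_)
    rw [P.mem_iff_mem_speri, Q.mem_iff_mem_speri, h]
  have hcont : Continuous (speri K) := by
    refine continuous_induced_rng.2 (continuous_generateFrom_iff.2 ?_)
    rintro _ ⟨a, rfl⟩
    change IsOpen {P : OrderSpace K | -(a : K) ∉ P.1}
    by_cases ha : (a : K) = 0
    · convert isOpen_empty
      ext P
      simp [ha]
    · simp only [OrderSpace.neg_notMem_iff _ ha]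
      exact OrderSpace.isOpen_setOf_mem _
  have hsurj : Function.Surjective (speri K) := fun α => by
    obtain ⟨P, hP⟩ := exists_speri_le α.1
    exact ⟨P, Subtype.ext (le_antisymm hP (α.2 hP))⟩
  refine isHomeomorph_iff_isEmbedding_surjective.2
    ⟨⟨⟨le_antisymm hcont.le_induced ?_⟩, hinj⟩, hsurj⟩
  refine le_generateFrom ?_
  rintro _ ⟨a, rfl⟩
  by_cases ha : a = 0
  · convert isOpen_univ
    ext P
    simp [ha]
  -- `-b = a / (1 + a²)` is positive at `P` if and only if `a` is
  let b : realHolomorphyRing K := ⟨_, mul_inv_one_add_sq_mem_realHolomorphyRing (-a)⟩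
  refine isOpen_induced_iff.2 ⟨Subtype.val ⁻¹' {α : RealSpectrum _ | b ∉ α.1}, ?_, ?_⟩
  · simpa using (RealSpectrum.isOpen_setOf_neg_notMem (-b)).preimage
      (continuous_subtype_val (p := fun α : RealSpectrum (realHolomorphyRing K) => IsMin α))
  · ext P
    change b ∉ (speri K P).1.1 ↔ a ∈ P.1
    rw [← P.mem_iff_mem_speri, P.neg_notMem_iff ha]

theorem continuous_sp (K : Type*) [Field K] : Continuous (sp (realHolomorphyRing K)) := by
  rw [(isHomeomorph_speri K).isQuotientMap.continuous_iff]
  refine ((continuous_j _).comp ((continuous_res K).comp (continuous_Lam K))).congr fun P => ?_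
  exact (sp_speri P).symm

theorem surjective_sp (K : Type*) [Field K] : Function.Surjective (sp (realHolomorphyRing K)) := by
  intro β
  obtain ⟨P, hP⟩ := exists_j_res_Lam_eq β
  exact ⟨speri K P, (sp_speri P).trans hP⟩

end RealPlaces

theorem mainTheorem5 (K : Type*) [Field K] :
    -- the square commutes
    (∀ P : RealPlaces.OrderSpace K,
      RealPlaces.sp (RealPlaces.realHolomorphyRing K) (RealPlaces.speri K P) =
        RealPlaces.j (RealPlaces.realHolomorphyRing K)
          (RealPlaces.res K (RealPlaces.Lam K P))) ∧
    -- the horizontal maps are homeomorphisms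
    IsHomeomorph (RealPlaces.speri K) ∧
    IsHomeomorph (RealPlaces.res K) ∧
    IsHomeomorph (RealPlaces.j (RealPlaces.realHolomorphyRing K)) ∧
    -- the vertical maps are continuous surjections
    (Continuous (RealPlaces.Lam K) ∧ Function.Surjective (RealPlaces.Lam K)) ∧
    (Continuous (RealPlaces.sp (RealPlaces.realHolomorphyRing K)) ∧
      Function.Surjective (RealPlaces.sp (RealPlaces.realHolomorphyRing K))) ∧
    -- the resulting homeomorphisms
    Nonempty (RealPlaces.OrderSpace K ≃ₜ
      RealPlaces.MinSper (RealPlaces.realHolomorphyRing K)) ∧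
    Nonempty (RealPlaces.PlaceSpace K ≃ₜ
      RealPlaces.MaxSper (RealPlaces.realHolomorphyRing K)) ∧
    -- all five spaces are compact Hausdorff, and two of the topologies are quotient topologies
    (CompactSpace (RealPlaces.OrderSpace K) ∧ T2Space (RealPlaces.OrderSpace K)) ∧
    (CompactSpace (RealPlaces.PlaceSpace K) ∧ T2Space (RealPlaces.PlaceSpace K)) ∧
    (CompactSpace (RealPlaces.RealHom (RealPlaces.realHolomorphyRing K)) ∧
      T2Space (RealPlaces.RealHom (RealPlaces.realHolomorphyRing K))) ∧
    (CompactSpace (RealPlaces.MinSper (RealPlaces.realHolomorphyRing K)) ∧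
      T2Space (RealPlaces.MinSper (RealPlaces.realHolomorphyRing K))) ∧
    (CompactSpace (RealPlaces.MaxSper (RealPlaces.realHolomorphyRing K)) ∧
      T2Space (RealPlaces.MaxSper (RealPlaces.realHolomorphyRing K))) ∧
    IsQuotientMap (RealPlaces.Lam K) ∧
    IsQuotientMap (RealPlaces.sp (RealPlaces.realHolomorphyRing K)) := by
  have hsperi := RealPlaces.isHomeomorph_speri K
  have hres := RealPlaces.isHomeomorph_res K
  have hj := RealPlaces.isHomeomorph_j K
  have : CompactSpace (RealPlaces.MinSper (RealPlaces.realHolomorphyRing K)) :=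
    hsperi.surjective.compactSpace hsperi.continuous
  have : T2Space (RealPlaces.MinSper (RealPlaces.realHolomorphyRing K)) :=
    (hsperi.homeomorph _).t2Space
  have : CompactSpace (RealPlaces.MaxSper (RealPlaces.realHolomorphyRing K)) :=
    hj.surjective.compactSpace hj.continuous
  have hLam := RealPlaces.continuous_Lam K
  have hLam' := RealPlaces.surjective_Lam K
  have hsp := RealPlaces.continuous_sp K
  have hsp' := RealPlaces.surjective_sp K
  exact ⟨RealPlaces.sp_speri, hsperi, hres, hj, ⟨hLam, hLam'⟩, ⟨hsp, hsp'⟩,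
    ⟨hsperi.homeomorph _⟩, ⟨(hj.comp hres).homeomorph _⟩,
    ⟨inferInstance, inferInstance⟩, ⟨inferInstance, inferInstance⟩,
    ⟨inferInstance, inferInstance⟩, ⟨inferInstance, inferInstance⟩,
    ⟨inferInstance, inferInstance⟩,
    .of_surjective_continuous hLam' hLam, .of_surjective_continuous hsp' hsp⟩
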